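/- All graphs are finite and simple. The average degree of a graph $G=(V,E)$ with $V\neq\emptyset$ is $\mathrm{Ad}(G)=\frac{1}{|V|}\sum_{v\in V}d(v)=2|E|/|V|$. An orientation of $G$ is a digraph with underlying graph $G$ that has at most one arc between each pair of vertices. A dicolouring of a digraph $D$ is a function $\varphi\colon V(D)\to\mathbb{Z}^+$ such that, for every $i\in\mathbb{Z}^+$, the subdigraph of $D$ induced by $\varphi^{-1}(i)$ has no directed cycle. A $k$-list assignment $L$ associates to each vertex $v$ a finite set $L(v)$ of at least $k$ positive integers, and an $L$-dicolouring is a dicolouring $\varphi$ with $\varphi(v)\in L(v)$ for every vertex $v$. The dichoosability $\vec{\chi}_\ell(D)$ of a digraph $D$ is the least integer $k\ge 0$ such that $D$ admits an $L$-dicolouring for every $k$-list assignment $L$, and the dichoosability $\vec{\chi}_\ell(G)$ of a graph $G$ is the maximum of $\vec{\chi}_\ell(D)$ over all orientations $D$ of $G$. **Theorem.** There exists $r_0\in\mathbb{N}$ such that, for every integer $r\ge r_0$, every graph $G$ with average degree $\mathrm{Ad}(G)\ge r^7 2^{3r+17}$ satisfies $\vec{\chi}_\ell(G)\ge r$. 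-/

import Mathlib

/-- `D` is an orientation of `G`: the underlying graph of `D` is `G`, and there is at most one arc
between each pair of vertices (with `v = w` this also excludes loops). -/
structure Digraph.IsOrientation {V : Type*} (D : Digraph V) (G : SimpleGraph V) : Prop where
  underlying : D.toSimpleGraphInclusive = G
  asymm : ∀ v w : V, D.Adj v w → ¬ D.Adj w v

/-- The directed cycle `c 0 → c 1 → ⋯ → c n → c 0` in `D`, on `n + 1` distinct vertices
(addition in `Fin (n + 1)` is cyclic). -/
def Digraph.IsDirectedCycle {V : Type*} (D : Digraph V) {n : ℕ} (c : Fin (n + 1) → V) : Prop :=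
  Function.Injective c ∧ ∀ i, D.Adj (c i) (c (i + 1))

/-- A digraph is acyclic if it has no directed cycles. -/
def Digraph.IsAcyclicDigraph {V : Type*} (D : Digraph V) : Prop :=
  ∀ (n : ℕ) (c : Fin (n + 1) → V), ¬ D.IsDirectedCycle c

/-- The subdigraph of `D` induced by a set `S` of vertices. -/
def Digraph.inducedOn {V : Type*} (D : Digraph V) (S : Set V) : Digraph S where
  Adj u v := D.Adj u v

/-- A dicolouring of `D`: every colour class induces an acyclic digraph. Colours are positive
integers. -/
def Digraph.IsDicolouring {V : Type*} (D : Digraph V) (φ : V → ℕ+) : Prop :=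
  ∀ i : ℕ+, (D.inducedOn (φ ⁻¹' {i})).IsAcyclicDigraph

/-- A `k`-list assignment: each vertex gets a finite set of at least `k` positive integers. -/
def IsListAssignment {V : Type*} (k : ℕ) (L : V → Finset ℕ+) : Prop :=
  ∀ v, k ≤ (L v).card

/-- For every `k`-list assignment `L`, the digraph `D` admits an `L`-dicolouring. -/
def Digraph.IsDichoosable {V : Type*} (D : Digraph V) (k : ℕ) : Prop :=
  ∀ L : V → Finset ℕ+, IsListAssignment k L →
    ∃ φ : V → ℕ+, (∀ v, φ v ∈ L v) ∧ D.IsDicolouring φ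

/-- The dichoosability of a digraph: the least `k` such that `D` admits an `L`-dicolouring for
every `k`-list assignment `L`. -/
noncomputable def Digraph.dichoosability {V : Type*} (D : Digraph V) : ℕ :=
  sInf {k : ℕ | D.IsDichoosable k}

/-- The dichoosability of a graph: the maximum dichoosability of its orientations. -/
noncomputable def SimpleGraph.dichoosability {V : Type*} (G : SimpleGraph V) : ℕ :=
  sSup {k : ℕ | ∃ D : Digraph V, D.IsOrientation G ∧ D.dichoosability = k}

/-- The average degree of a finite graph. -/
noncomputable def SimpleGraph.averageDegree {V : Type*} [Fintype V] (G : SimpleGraph V)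
    [DecidableRel G.Adj] : ℝ :=
  (∑ v, (G.degree v : ℝ)) / (Fintype.card V : ℝ)

/-- A finite loopless digraph is `|V|`-dichoosable, so that the least `k` in the definition of
`Digraph.dichoosability` exists. -/
theorem Digraph.isDichoosable_card {V : Type*} [Fintype V] (D : Digraph V)
    (hD : ∀ v, ¬ D.Adj v v) : D.IsDichoosable (Fintype.card V) := by
  classical
  intro L hL
  obtain ⟨φ, hφ, hmem⟩ := (Finset.all_card_le_biUnion_card_iff_exists_injective L).1 (by
    intro s
    rcases s.eq_empty_or_nonempty with rfl | ⟨v, hv⟩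
    · simp
    · exact (Finset.card_le_univ s).trans ((hL v).trans
        (Finset.card_le_card (Finset.subset_biUnion_of_mem L hv))))
  refine ⟨φ, hmem, fun i n c hc => ?_⟩
  have h0 : ((c 0 : V)) = c (0 + 1) :=
    hφ ((c 0).2.trans (c (0 + 1)).2.symm)
  have h1 : D.Adj (c 0) (c (0 + 1)) := hc.2 0
  rw [← h0] at h1
  exact hD _ h1

/-- Every graph has an orientation. -/
theorem SimpleGraph.exists_isOrientation {V : Type*} (G : SimpleGraph V) :
    ∃ D : Digraph V, D.IsOrientation G := by
  refine ⟨⟨fun v w => G.Adj v w ∧ WellOrderingRel v w⟩, ?_, ?_⟩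
  · ext v w
    simp only [Digraph.toSimpleGraphInclusive, SimpleGraph.fromRel_adj]
    constructor
    · rintro ⟨_, h | h⟩
      · exact h.1
      · exact h.1.symm
    · intro h
      refine ⟨h.ne, ?_⟩
      rcases trichotomous_of WellOrderingRel v w with h' | h' | h'
      · exact Or.inl ⟨h, h'⟩
      · exact absurd h' h.ne
      · exact Or.inr ⟨h.symm, h'⟩
  · rintro v w ⟨_, h⟩ ⟨_, h'⟩
    exact asymm_of WellOrderingRel h h'

/-- On a finite graph the maximum in the definition of `SimpleGraph.dichoosability` is attained. -/
theorem SimpleGraph.isGreatest_dichoosability {V : Type*} [Finite V] (G : SimpleGraph V) :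
    IsGreatest {k : ℕ | ∃ D : Digraph V, D.IsOrientation G ∧ D.dichoosability = k}
      G.dichoosability := by
  have := Fintype.ofFinite V
  have hb : BddAbove {k : ℕ | ∃ D : Digraph V, D.IsOrientation G ∧ D.dichoosability = k} := by
    refine ⟨Fintype.card V, ?_⟩
    rintro k ⟨D, hD, rfl⟩
    exact Nat.sInf_le (D.isDichoosable_card fun v h => hD.asymm v v h h)
  obtain ⟨D, hD⟩ := G.exists_isOrientation
  exact ⟨Nat.sSup_mem ⟨_, D, hD, rfl⟩ hb, fun k hk => le_csSup hb hk⟩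

/-! Pass to an induced subgraph of large minimum degree, on `n` vertices, and let `k` be the list
size. The aim is to find lists of size `k`, from a palette of `4 * k ^ 2` colours, such that every
list colouring has at least `k * n` monochromatic edges. For a fixed colouring with `m`
monochromatic edges, a uniformly random orientation has no monochromatic directed cycle with
probability at most `2 ^ n * (3 / 4) ^ m`. Indeed, such orientations form a set family, which by
Sauer–Shelah (in Pajor's form) has at most as many members as it has shattered sets; and a shattered
set meets the monochromatic edges in a forest, since a cycle could be oriented cyclically. A union
bound over at most `(4 * k ^ 2) ^ n` colourings leaves an orientation that defeats all of them.

The lists are random, in two rounds (`exists_lists_forall_many_monoEdges`). A sparse random set `B`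
receives its lists first; most vertices outside `B` see, for every half of the palette, many
neighbours in `B` with list inside that half. By pigeonhole, under any list colouring of `B` at
least half of the palette is frequent around such a vertex `a`. The list of `a`, drawn afterwards,
consists of frequent colours with probability at least `2⁻ᵏ⁻¹`, and then every choice of colour at
`a` creates many monochromatic edges. Since `B` is sparse, it has few enough colourings for one
choice of lists outside `B` to serve all of them. -/

open Finset

/-! ### Shattering and random orientations -/

/-- An acyclic graph has at most as many edges as vertices. -/
theorem SimpleGraph.IsAcyclic.card_edgeFinset_le {V : Type*} [Fintype V] {G : SimpleGraph V}
    [Fintype G.edgeSet] (hG : G.IsAcyclic) : #G.edgeFinset ≤ Fintype.card V := by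
  classical
  rcases isEmpty_or_nonempty V with h | h
  · have : G.edgeFinset = ∅ := by
      ext e
      induction e with
      | _ a b => exact h.elim a
    simp [this]
  · obtain ⟨T, hGT, -, hT⟩ :=
      (SimpleGraph.connected_top (V := V)).exists_isTree_le_of_le_of_isAcyclic le_top hG
    have h1 := hT.card_edgeFinset
    have h2 : #G.edgeFinset ≤ #T.edgeFinset :=
      Finset.card_le_card (SimpleGraph.edgeFinset_subset_edgeFinset.2 hGT)
    omega

/-- A directed cycle all of whose vertices get the same colour. -/
def Digraph.HasMonoCycle {V Q : Type*} (D : Digraph V) (φ : V → Q) : Prop :=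
  ∃ (n : ℕ) (c : Fin (n + 1) → V), D.IsDirectedCycle c ∧ ∀ i, φ (c i) = φ (c 0)

theorem Digraph.HasMonoCycle.not_isDicolouring {V : Type*} {D : Digraph V} {φ : V → ℕ+}
    (h : D.HasMonoCycle φ) : ¬ D.IsDicolouring φ := by
  obtain ⟨n, c, hc, hφ⟩ := h
  intro hD
  exact hD (φ (c 0)) n (fun i => ⟨c i, hφ i⟩)
    ⟨fun i j hij => hc.1 (Subtype.ext_iff.1 hij), fun i => hc.2 i⟩

/-- The orientation of `G` in which the edges in `F` point upwards and all others downwards. -/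
def SimpleGraph.orientationOf {V : Type*} [LinearOrder V] (G : SimpleGraph V)
    (F : Finset (Sym2 V)) : Digraph V where
  Adj u v := G.Adj u v ∧ (s(u, v) ∈ F ↔ u < v)

theorem SimpleGraph.isOrientation_orientationOf {V : Type*} [LinearOrder V] (G : SimpleGraph V)
    (F : Finset (Sym2 V)) : (G.orientationOf F).IsOrientation G := by
  refine ⟨?_, ?_⟩
  · ext v w
    simp only [Digraph.toSimpleGraphInclusive, SimpleGraph.fromRel_adj, orientationOf,
      Sym2.eq_swap (a := w)]
    constructor
    · rintro ⟨_, h | h⟩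
      · exact h.1
      · exact h.1.symm
    · intro h
      refine ⟨h.ne, ?_⟩
      rcases lt_or_gt_of_ne h.ne with h' | h' <;> by_cases hF : s(v, w) ∈ F <;>
        simp [h, h.symm, hF, h', h'.not_gt]
  · rintro v w ⟨h, h1⟩ ⟨-, h2⟩
    rw [Sym2.eq_swap, h1] at h2
    rcases lt_or_gt_of_ne h.ne with h' | h'
    · exact absurd (h2.1 h') h'.not_gt
    · exact absurd (h2.2 h') h'.not_gt

/-- The monochromatic edges of a colouring. -/
def SimpleGraph.monoEdges {V Q : Type*} [Fintype V] [DecidableEq V] [DecidableEq Q]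
    (G : SimpleGraph V) [DecidableRel G.Adj] (φ : V → Q) : Finset (Sym2 V) :=
  {e ∈ G.edgeFinset | (e.map φ).IsDiag}

theorem SimpleGraph.mk_mem_monoEdges {V Q : Type*} [Fintype V] [DecidableEq V] [DecidableEq Q]
    {G : SimpleGraph V} [DecidableRel G.Adj] {φ : V → Q} {u v : V} :
    s(u, v) ∈ G.monoEdges φ ↔ G.Adj u v ∧ φ u = φ v := by
  simp [monoEdges]

/-- If every choice of directions on the edges in `s` extends to an orientation without
monochromatic directed cycle, then the monochromatic edges in `s` form a forest. -/
theorem SimpleGraph.card_inter_monoEdges_le_of_shatters {V Q : Type*} [Fintype V] [LinearOrder V]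
    [DecidableEq Q] (G : SimpleGraph V) [DecidableRel G.Adj] (φ : V → Q)
    {𝒜 : Finset (Finset (Sym2 V))} (h𝒜 : ∀ F ∈ 𝒜, ¬ (G.orientationOf F).HasMonoCycle φ)
    {s : Finset (Sym2 V)} (hs : 𝒜.Shatters s) :
    #(s ∩ G.monoEdges φ) ≤ Fintype.card V := by
  classical
  set t := s ∩ G.monoEdges φ with ht
  set H : SimpleGraph V := SimpleGraph.fromEdgeSet (t : Set (Sym2 V)) with hH
  have hadj : ∀ u v, H.Adj u v → s(u, v) ∈ s ∧ G.Adj u v ∧ φ u = φ v := by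
    intro u v huv
    have h1 : s(u, v) ∈ t := by simpa using ((SimpleGraph.fromEdgeSet_adj _).1 huv).1
    rw [ht, Finset.mem_inter, SimpleGraph.mk_mem_monoEdges] at h1
    exact h1
  have hedge : H.edgeFinset = t := by
    ext e
    rw [SimpleGraph.mem_edgeFinset, hH, SimpleGraph.edgeSet_fromEdgeSet]
    constructor
    · intro h
      simpa using h.1
    · intro h
      refine ⟨by simpa using h, ?_⟩
      induction e with
      | _ u v =>
        have := (SimpleGraph.mk_mem_monoEdges.1 (Finset.mem_inter.1 h).2).1.ne
        simpa using this
  have hac : H.IsAcyclic := by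
    rw [SimpleGraph.isAcyclic_iff_free_cycleGraph]
    rintro (_ | n) hn ⟨f⟩
    · omega
    -- The cycle has length at least 3, so no edge is traversed in both directions.
    have hne : ∀ i : Fin (n + 1), i + 1 + 1 ≠ i := by
      intro i hi
      have h2 : (1 + 1 : Fin (n + 1)) = 0 := by
        have : i + (1 + 1) = i + 0 := by rw [← add_assoc, hi, add_zero]
        exact add_left_cancel this
      have := congrArg Fin.val h2
      rw [Fin.val_add, Fin.val_one', Fin.val_zero, Nat.mod_eq_of_lt (a := 1) (by omega),
        Nat.mod_eq_of_lt (by omega)] at this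
      omega
    have hf : ∀ i : Fin (n + 1), H.Adj (f i) (f (i + 1)) := by
      intro i
      apply f.toHom.map_adj
      obtain ⟨m, rfl⟩ : ∃ m, n = m + 1 := ⟨n - 1, by omega⟩
      rw [SimpleGraph.cycleGraph_adj]
      right
      simp
    have hinj : Function.Injective f := f.injective
    -- The prescribed trace consists of the cycle edges that `f` traverses upwards; every
    -- orientation with this trace directs the cycle along `f`.
    obtain ⟨F, hF, hFt⟩ := hs (t := {e ∈ s | ∃ i, e = s(f i, f (i + 1)) ∧ f i < f (i + 1)})
      (Finset.filter_subset _ _)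
    refine h𝒜 F hF ⟨n, f, ⟨hinj, fun i => ⟨(hadj _ _ (hf i)).2.1, ?_⟩⟩, ?_⟩
    · have hmem : s(f i, f (i + 1)) ∈ F ↔
          ∃ j, s(f i, f (i + 1)) = s(f j, f (j + 1)) ∧ f j < f (j + 1) := by
        have := congrArg (s(f i, f (i + 1)) ∈ ·) hFt
        simpa [(hadj _ _ (hf i)).1] using this
      rw [hmem]
      constructor
      · rintro ⟨j, hj, hlt⟩
        rcases Sym2.eq_iff.1 hj with ⟨h1, h2⟩ | ⟨h1, h2⟩
        · rwa [h1, h2]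
        · exfalso
          have h1 := hinj h1
          have h2 := hinj h2
          rw [h1] at h2
          exact hne j h2
      · exact fun h => ⟨i, rfl, h⟩
    · intro i
      induction i using Fin.induction with
      | zero => rfl
      | succ i ih =>
        rw [← ih]
        have := (hadj _ _ (hf i.castSucc)).2.2
        rw [show i.castSucc + 1 = i.succ by simp] at this
        exact this.symm
  rw [← hedge]
  exact hac.card_edgeFinset_le

/-- Among the orientations of `G`, the fraction without a monochromatic directed cycle is at most
`2 ^ n * (3 / 4) ^ m`, for `n` vertices and `m` monochromatic edges. -/
theorem SimpleGraph.card_orientations_without_monoCycle_le {V Q : Type*} [Fintype V]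
    [LinearOrder V] [DecidableEq Q] (G : SimpleGraph V) [DecidableRel G.Adj] (φ : V → Q)
    {𝒜 : Finset (Finset (Sym2 V))} (hG : ∀ F ∈ 𝒜, F ⊆ G.edgeFinset)
    (h𝒜 : ∀ F ∈ 𝒜, ¬ (G.orientationOf F).HasMonoCycle φ) :
    (#𝒜 : ℝ) ≤ 2 ^ Fintype.card V * (3 / 4) ^ #(G.monoEdges φ) * 2 ^ #G.edgeFinset := by
  classical
  have hsub : G.monoEdges φ ⊆ G.edgeFinset := Finset.filter_subset _ _
  have hsh : 𝒜.shatterer ⊆ {s ∈ G.edgeFinset.powerset |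
      #(s ∩ G.monoEdges φ) ≤ Fintype.card V} := by
    intro s hs
    rw [Finset.mem_shatterer] at hs
    obtain ⟨F, hF, hsF⟩ := hs.exists_superset
    exact Finset.mem_filter.2 ⟨Finset.mem_powerset.2 (hsF.trans (hG F hF)),
      G.card_inter_monoEdges_le_of_shatters φ h𝒜 hs⟩
  -- Exponential weights: `2 ^ n * ∏ e ∈ s, w e` is at least 1 on each set `s` counted, and its sum
  -- over all edge sets factors, each monochromatic edge contributing `3 / 2 = 2 * (3 / 4)`.
  set w : Sym2 V → ℝ := fun e => if e ∈ G.monoEdges φ then 1 / 2 else 1 with hw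
  have hprod : ∀ s : Finset (Sym2 V), ∏ e ∈ s, w e = (1 / 2) ^ #(s ∩ G.monoEdges φ) := by
    intro s
    simp [hw]
  calc (#𝒜 : ℝ) ≤ #{s ∈ G.edgeFinset.powerset | #(s ∩ G.monoEdges φ) ≤ Fintype.card V} := by
        exact_mod_cast 𝒜.card_le_card_shatterer.trans (Finset.card_le_card hsh)
    _ = ∑ s ∈ G.edgeFinset.powerset with #(s ∩ G.monoEdges φ) ≤ Fintype.card V, (1 : ℝ) := by simp
    _ ≤ ∑ s ∈ G.edgeFinset.powerset with #(s ∩ G.monoEdges φ) ≤ Fintype.card V,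
          2 ^ Fintype.card V * ∏ e ∈ s, w e := by
        refine Finset.sum_le_sum fun s hs => ?_
        rw [hprod, one_div, inv_pow, ← div_eq_mul_inv, one_le_div (by positivity)]
        exact pow_le_pow_right₀ (by norm_num) (Finset.mem_filter.1 hs).2
    _ ≤ ∑ s ∈ G.edgeFinset.powerset, 2 ^ Fintype.card V * ∏ e ∈ s, w e := by
        refine Finset.sum_le_sum_of_subset_of_nonneg (Finset.filter_subset _ _) fun s _ _ => ?_
        rw [hprod]
        positivity
    _ = 2 ^ Fintype.card V * ∏ e ∈ G.edgeFinset, (1 + w e) := by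
        rw [Finset.prod_one_add, Finset.mul_sum]
    _ = 2 ^ Fintype.card V * ∏ e ∈ G.edgeFinset, (2 * if e ∈ G.monoEdges φ then 3 / 4 else 1) := by
        congr 1
        refine Finset.prod_congr rfl fun e _ => ?_
        simp only [hw]
        split_ifs <;> norm_num
    _ = _ := by
        rw [Finset.prod_mul_distrib, Finset.prod_const, Finset.prod_ite, Finset.prod_const,
          Finset.prod_const_one, mul_one, Finset.filter_mem_eq_inter,
          Finset.inter_eq_right.2 hsub]
        ring

/-- If each colouring in a small family has many monochromatic edges, then some orientation
produces a monochromatic directed cycle for all of them. -/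
theorem SimpleGraph.exists_orientation_forall_hasMonoCycle {V Q : Type*} [Fintype V]
    [DecidableEq V] [DecidableEq Q] (G : SimpleGraph V) [DecidableRel G.Adj] (Φ : Finset (V → Q))
    (m : ℕ) (hm : ∀ φ ∈ Φ, m ≤ #(G.monoEdges φ))
    (hΦ : (#Φ : ℝ) * (2 ^ Fintype.card V * (3 / 4) ^ m) < 1) :
    ∃ D : Digraph V, D.IsOrientation G ∧ ∀ φ ∈ Φ, D.HasMonoCycle φ := by
  classical
  let _ : LinearOrder V := LinearOrder.lift' (Fintype.equivFin V) (Fintype.equivFin V).injective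
  by_contra! hcon
  let bad : (V → Q) → Finset (Finset (Sym2 V)) := fun φ =>
    {F ∈ G.edgeFinset.powerset | ¬ (G.orientationOf F).HasMonoCycle φ}
  have hcover : G.edgeFinset.powerset ⊆ Φ.biUnion bad := by
    intro F hF
    obtain ⟨φ, hφ, h⟩ := hcon _ (G.isOrientation_orientationOf F)
    exact Finset.mem_biUnion.2 ⟨φ, hφ, Finset.mem_filter.2 ⟨hF, h⟩⟩
  have h1 : (2 : ℝ) ^ #G.edgeFinset ≤ ∑ φ ∈ Φ, (#(bad φ) : ℝ) := by
    have := (Finset.card_le_card hcover).trans Finset.card_biUnion_le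
    rw [Finset.card_powerset] at this
    exact_mod_cast this
  have h2 : ∀ φ ∈ Φ, (#(bad φ) : ℝ) ≤ 2 ^ Fintype.card V * (3 / 4) ^ m * 2 ^ #G.edgeFinset := by
    intro φ hφ
    have := G.card_orientations_without_monoCycle_le φ (𝒜 := bad φ)
      (fun F hF => Finset.mem_powerset.1 (Finset.mem_filter.1 hF).1)
      (fun F hF => (Finset.mem_filter.1 hF).2)
    have h3 : (3 / 4 : ℝ) ^ #(G.monoEdges φ) ≤ (3 / 4) ^ m :=
      pow_le_pow_of_le_one (by norm_num) (by norm_num) (hm φ hφ)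
    have h4 : (2 : ℝ) ^ Fintype.card V * (3 / 4) ^ #(G.monoEdges φ) * 2 ^ #G.edgeFinset ≤
        2 ^ Fintype.card V * (3 / 4) ^ m * 2 ^ #G.edgeFinset :=
      mul_le_mul_of_nonneg_right (mul_le_mul_of_nonneg_left h3 (by positivity)) (by positivity)
    refine le_trans ?_ h4
    convert this
    rfl
  have h3 := h1.trans (Finset.sum_le_sum h2)
  rw [Finset.sum_const, nsmul_eq_mul] at h3
  have h4 : (0 : ℝ) < 2 ^ #G.edgeFinset := by positivity
  nlinarith

/-! ### Tail bounds and random labellings -/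

/-- A lower tail bound: if each of the independent events `f v ∈ P v`, `v ∈ W`, has probability at
least `x`, and `4 * m ≤ x * #W`, then fewer than `m` of them happen with probability at most
`2⁻ᵐ`. -/
theorem card_functions_few_hits_le {V Λ : Type*} [Fintype V] [DecidableEq V] [Fintype Λ]
    [DecidableEq Λ] (W : Finset V) (P : V → Finset Λ) {x : ℝ}
    (hP : ∀ v ∈ W, x * Fintype.card Λ ≤ #(P v)) {m : ℕ} (hm : 4 * m ≤ x * #W) :
    (#{f : V → Λ | #{v ∈ W | f v ∈ P v} < m} : ℝ) * 2 ^ m ≤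
      (Fintype.card Λ : ℝ) ^ Fintype.card V := by
  -- The product of the `g v (f v)` is `(1 / 2) ^ h` for `h` hits. Its mean is at most `exp (-(x *
  -- #W / 2)) ≤ (1 / 4) ^ m`, and Markov's inequality concludes.
  set g : V → Λ → ℝ := fun v l => if v ∈ W ∧ l ∈ P v then 1 / 2 else 1 with hg
  have hprod : ∀ f : V → Λ, ∏ v, g v (f v) = (1 / 2) ^ #{v ∈ W | f v ∈ P v} := by
    intro f
    have : ({v | v ∈ W ∧ f v ∈ P v} : Finset V) = {v ∈ W | f v ∈ P v} := by
      ext v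
      simp
    simp only [hg]
    rw [Finset.prod_ite, Finset.prod_const_one, mul_one, Finset.prod_const, this]
  have hsum : ∀ v, ∑ l, g v l ≤
      Fintype.card Λ * (if v ∈ W then Real.exp (-(x / 2)) else 1) := by
    intro v
    by_cases hv : v ∈ W
    · have h1 : ∑ l, g v l = Fintype.card Λ - #(P v) / 2 := by
        have : ∀ l, g v l = 1 - (if l ∈ P v then 1 / 2 else 0) := by
          intro l
          simp only [hg, hv, true_and]
          split_ifs <;> norm_num
        simp only [this, Finset.sum_sub_distrib, Finset.sum_ite_mem, Finset.univ_inter]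
        simp [div_eq_mul_inv]
      have h2 := hP v hv
      have h3 := Real.add_one_le_exp (-(x / 2))
      have h4 : (0 : ℝ) ≤ Fintype.card Λ := by positivity
      rw [h1, if_pos hv]
      nlinarith
    · simp [hg, hv]
  have htot : ∑ f : V → Λ, ∏ v, g v (f v) ≤
      (Fintype.card Λ : ℝ) ^ Fintype.card V * (1 / 4) ^ m := by
    rw [← Fintype.prod_sum]
    calc ∏ v, ∑ l, g v l
        ≤ ∏ v, (Fintype.card Λ * (if v ∈ W then Real.exp (-(x / 2)) else 1) : ℝ) := by
          refine Finset.prod_le_prod (fun v _ => Finset.sum_nonneg fun l _ => ?_)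
            fun v _ => hsum v
          simp only [hg]
          split_ifs <;> norm_num
      _ = (Fintype.card Λ : ℝ) ^ Fintype.card V * Real.exp (-(x * #W / 2)) := by
          rw [Finset.prod_mul_distrib, Finset.prod_const, Finset.prod_ite_mem, Finset.univ_inter,
            Finset.prod_const, ← Real.exp_nat_mul, Finset.card_univ]
          ring_nf
      _ ≤ (Fintype.card Λ : ℝ) ^ Fintype.card V * (1 / 4) ^ m := by
          refine mul_le_mul_of_nonneg_left ?_ (by positivity)
          have h1 : Real.exp (-(x * #W / 2)) ≤ Real.exp (m * (-2)) :=
            Real.exp_le_exp.2 (by linarith)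
          refine h1.trans ?_
          rw [Real.exp_nat_mul]
          refine pow_le_pow_left₀ (Real.exp_nonneg _) ?_ _
          have h2 : (2 : ℝ) ≤ Real.exp 1 := by
            have := Real.add_one_le_exp (1 : ℝ)
            linarith
          have h3 : Real.exp (-2) = (Real.exp 1 * Real.exp 1)⁻¹ := by
            rw [← Real.exp_add, ← Real.exp_neg]
            norm_num
          rw [h3, one_div]
          exact inv_anti₀ (by norm_num) (by nlinarith)
  have hlow : (#{f : V → Λ | #{v ∈ W | f v ∈ P v} < m} : ℝ) * (1 / 2) ^ m ≤
      ∑ f : V → Λ, ∏ v, g v (f v) := by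
    rw [← nsmul_eq_mul]
    refine le_trans (Finset.card_nsmul_le_sum _ _ _ fun f hf => ?_)
      (Finset.sum_le_sum_of_subset_of_nonneg (Finset.subset_univ _) fun f _ _ => ?_)
    · rw [hprod]
      exact pow_le_pow_of_le_one (by norm_num) (by norm_num) (Finset.mem_filter.1 hf).2.le
    · rw [hprod]
      positivity
  have h1 := mul_le_mul_of_nonneg_right (hlow.trans htot) (by positivity : (0 : ℝ) ≤ 4 ^ m)
  have h2 : (1 / 2 : ℝ) ^ m * 4 ^ m = 2 ^ m := by rw [← mul_pow]; norm_num
  have h3 : (1 / 4 : ℝ) ^ m * 4 ^ m = 1 := by rw [← mul_pow]; norm_num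
  rwa [mul_assoc, h2, mul_assoc, h3, mul_one] at h1

theorem card_functions_apply_mem {V Λ : Type*} [Fintype V] [DecidableEq V] [Fintype Λ]
    [DecidableEq Λ] (a : V) (P : Finset Λ) :
    #{f : V → Λ | f a ∈ P} * Fintype.card Λ = #P * Fintype.card Λ ^ Fintype.card V := by
  have h : ({f : V → Λ | f a ∈ P} : Finset (V → Λ)) =
      Fintype.piFinset fun v => if v = a then P else univ := by
    ext f
    simp only [Finset.mem_filter, Finset.mem_univ, true_and, Fintype.mem_piFinset]
    constructor
    · intro h v
      split_ifs with hv
      · rwa [hv]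
      · exact Finset.mem_univ _
    · intro h
      simpa using h a
  rw [h, Fintype.card_piFinset, ← Finset.mul_prod_erase _ _ (Finset.mem_univ a),
    Finset.prod_congr (g := fun _ => Fintype.card Λ) rfl fun v hv => by
      simp [Finset.ne_of_mem_erase hv]]
  rw [if_pos rfl, Finset.prod_const, mul_assoc, ← pow_succ, Finset.card_erase_of_mem
    (Finset.mem_univ a), Finset.card_univ, Nat.sub_add_cancel (Fintype.card_pos_iff.2 ⟨a⟩)]

/-- In a graph of large minimum degree one can choose a sparse set `B` of vertices and labels on
`B` such that most vertices lie outside `B` and see, for every `i`, at least `m` neighbours in `B`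
with label in `P i`. -/
theorem SimpleGraph.exists_sparse_labelling {V Λ ι : Type*} [Fintype V] [DecidableEq V]
    [Fintype Λ] [DecidableEq Λ] [Nonempty Λ] [Fintype ι] (G : SimpleGraph V) [DecidableRel G.Adj]
    (P : ι → Finset Λ) {ρ : ℝ} (hP : ∀ i, ρ * Fintype.card Λ ≤ #(P i)) {N m : ℕ} (hN : 0 < N)
    (hdeg : ∀ a, 4 * m * N ≤ ρ * G.degree a) (hι : Fintype.card ι * N ≤ 2 ^ m) :
    ∃ (B : Finset V) (S : V → Λ),
      #{a | a ∈ B ∨ ∃ i, #{b ∈ G.neighborFinset a | b ∈ B ∧ S b ∈ P i} < m} * N ≤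
        2 * Fintype.card V := by
  classical
  have : NeZero N := ⟨hN.ne'⟩
  have hN' : (0 : ℝ) < N := by exact_mod_cast hN
  set K : ℝ := (Fintype.card (Λ × Fin N) : ℝ) ^ Fintype.card V with hK
  have hKpos : 0 < K := by positivity
  -- The second coordinate encodes `B`: it is `0` with probability `1 / N`. Each of the two
  -- alternatives has probability at most `1 / N`, the second by the tail bound and `hι`.
  let bad : V → (V → Λ × Fin N) → Prop := fun a f =>
    (f a).2 = 0 ∨ ∃ i, #{b ∈ G.neighborFinset a | f b ∈ P i ×ˢ {0}} < m
  have h0 : ∀ a, (#{f : V → Λ × Fin N | (f a).2 = 0} : ℝ) * N = K := by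
    intro a
    have h := card_functions_apply_mem a ((univ : Finset Λ) ×ˢ ({0} : Finset (Fin N)))
    simp only [Finset.mem_product, Finset.mem_univ, true_and, Finset.mem_singleton,
      Finset.card_product, Finset.card_univ, Finset.card_singleton, mul_one] at h
    have h' : (#{f : V → Λ × Fin N | (f a).2 = 0} : ℝ) * (Fintype.card Λ * N) =
        Fintype.card Λ * K := by
      rw [hK]
      have : Fintype.card (Λ × Fin N) = Fintype.card Λ * N := by simp
      rw [← Nat.cast_mul, ← this]
      exact_mod_cast h
    have hΛ : (0 : ℝ) < Fintype.card Λ := by exact_mod_cast Fintype.card_pos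
    apply mul_left_cancel₀ hΛ.ne'
    linarith
  have h1 : ∀ a i, (#{f : V → Λ × Fin N |
      #{b ∈ G.neighborFinset a | f b ∈ P i ×ˢ {0}} < m} : ℝ) * 2 ^ m ≤ K := by
    intro a i
    refine card_functions_few_hits_le (x := ρ / N) _ _ (fun v _ => ?_) ?_
    · rw [Finset.card_product, Finset.card_singleton, mul_one, Fintype.card_prod,
        Fintype.card_fin, Nat.cast_mul]
      refine le_trans (le_of_eq ?_) (hP i)
      field_simp
    · rw [SimpleGraph.card_neighborFinset_eq_degree, div_mul_eq_mul_div, le_div_iff₀ hN']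
      exact hdeg a
  have hbad : ∀ a, (#{f | bad a f} : ℝ) * N ≤ 2 * K := by
    intro a
    have hsub : ({f | bad a f} : Finset (V → Λ × Fin N)) ⊆
        ({f | (f a).2 = 0} : Finset (V → Λ × Fin N)) ∪ univ.biUnion fun i : ι =>
          {f : V → Λ × Fin N | #{b ∈ G.neighborFinset a | f b ∈ P i ×ˢ {0}} < m} := by
      intro f hf
      rcases (Finset.mem_filter.1 hf).2 with h | ⟨i, h⟩
      · exact Finset.mem_union_left _ (by simpa using h)
      · exact Finset.mem_union_right _ (Finset.mem_biUnion.2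
          ⟨i, Finset.mem_univ _, Finset.mem_filter.2 ⟨Finset.mem_univ _, h⟩⟩)
    have h2 : (#{f | bad a f} : ℝ) ≤ #{f : V → Λ × Fin N | (f a).2 = 0} + ∑ i : ι,
        (#{f : V → Λ × Fin N | #{b ∈ G.neighborFinset a | f b ∈ P i ×ˢ {0}} < m} : ℝ) := by
      exact_mod_cast (Finset.card_le_card hsub).trans
        ((Finset.card_union_le _ _).trans (Nat.add_le_add_left Finset.card_biUnion_le _))
    have h3 : ∑ i : ι,
        (#{f : V → Λ × Fin N | #{b ∈ G.neighborFinset a | f b ∈ P i ×ˢ {0}} < m} : ℝ) ≤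
        Fintype.card ι * (K / 2 ^ m) := by
      rw [← nsmul_eq_mul, ← Finset.card_univ]
      exact Finset.sum_le_card_nsmul _ _ _ fun i _ => (le_div_iff₀ (by positivity)).2 (h1 a i)
    have h4 : (Fintype.card ι : ℝ) * (K / 2 ^ m) * N ≤ K := by
      have : (Fintype.card ι : ℝ) * N ≤ 2 ^ m := by exact_mod_cast hι
      rw [mul_right_comm, ← mul_div_assoc, div_le_iff₀ (by positivity), mul_comm K]
      exact mul_le_mul_of_nonneg_right this hKpos.le
    have h5 := h0 a
    nlinarith
  have hsum : ∑ f : V → Λ × Fin N, (#{a | bad a f} : ℝ) * N ≤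
      ∑ f : V → Λ × Fin N, (2 * Fintype.card V : ℝ) := by
    rw [← Finset.sum_mul, ← Nat.cast_sum]
    have hswap : ∑ f : V → Λ × Fin N, #{a | bad a f} = ∑ a, #{f | bad a f} := by
      simp only [Finset.card_filter]
      exact Finset.sum_comm
    rw [hswap, Nat.cast_sum, Finset.sum_mul]
    refine (Finset.sum_le_card_nsmul _ _ _ fun a _ => hbad a).trans (le_of_eq ?_)
    simp only [Finset.card_univ, nsmul_eq_mul, Finset.sum_const, Fintype.card_fun, hK]
    push_cast
    ring
  have hne : (univ : Finset (V → Λ × Fin N)).Nonempty := Finset.univ_nonempty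
  obtain ⟨f, -, hf⟩ := Finset.exists_le_of_sum_le hne hsum
  refine ⟨({b | (f b).2 = 0} : Finset V), fun b => (f b).1, ?_⟩
  refine le_trans (Nat.mul_le_mul_right _ (Finset.card_le_card fun a ha => ?_))
    (by exact_mod_cast hf : #{a | bad a f} * N ≤ 2 * Fintype.card V)
  simp only [bad, Finset.mem_filter, Finset.mem_univ, true_and, Finset.mem_product,
    Finset.mem_singleton, and_comm] at ha ⊢
  exact ha

/-- If `Φ` is small and each of the events `R a ∈ P φ a` has probability at least `ρ`, then some
`R` makes at least `m` of these events happen for each `φ` simultaneously. -/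
theorem exists_function_forall_many_hits {V Λ Φ : Type*} [Fintype V] [DecidableEq V] [Fintype Λ]
    [DecidableEq Λ] [Nonempty Λ] [Fintype Φ] (A : Finset V) (P : Φ → V → Finset Λ) {ρ : ℝ}
    (hP : ∀ φ, ∀ a ∈ A, ρ * Fintype.card Λ ≤ #(P φ a)) {m : ℕ} (hm : 4 * m ≤ ρ * #A)
    (hΦ : Fintype.card Φ < 2 ^ m) :
    ∃ R : V → Λ, ∀ φ, m ≤ #{a ∈ A | R a ∈ P φ a} := by
  classical
  by_contra! hcon
  set K : ℝ := (Fintype.card Λ : ℝ) ^ Fintype.card V with hK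
  have hKpos : 0 < K := by positivity
  have hcover : (univ : Finset (V → Λ)) ⊆
      univ.biUnion fun φ => {R : V → Λ | #{a ∈ A | R a ∈ P φ a} < m} := by
    intro R _
    obtain ⟨φ, hφ⟩ := hcon R
    exact Finset.mem_biUnion.2 ⟨φ, Finset.mem_univ _, by simpa using hφ⟩
  have h1 : K ≤ ∑ φ, (#{R : V → Λ | #{a ∈ A | R a ∈ P φ a} < m} : ℝ) := by
    have := (Finset.card_le_card hcover).trans Finset.card_biUnion_le
    rw [Finset.card_univ, Fintype.card_fun] at this
    rw [hK]
    exact_mod_cast this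
  have h2 : ∑ φ, (#{R : V → Λ | #{a ∈ A | R a ∈ P φ a} < m} : ℝ) ≤
      Fintype.card Φ * (K / 2 ^ m) := by
    rw [← nsmul_eq_mul, ← Finset.card_univ]
    exact Finset.sum_le_card_nsmul _ _ _ fun φ _ =>
      (le_div_iff₀ (by positivity)).2 (card_functions_few_hits_le A (P φ) (hP φ) hm)
  have h3 := h1.trans h2
  rw [← mul_div_assoc, le_div_iff₀ (by positivity), mul_comm] at h3
  have h4 : (2 : ℝ) ^ m ≤ Fintype.card Φ := le_of_mul_le_mul_right h3 hKpos
  exact absurd hΦ (not_lt.2 (by exact_mod_cast h4))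

/-! ### Lists forcing many monochromatic edges -/

/-- A `k`-subset of a `4 * k ^ 2`-set lies in a given half of it with probability at least
`2⁻ᵏ⁻¹`. -/
theorem choose_four_mul_sq_le {k : ℕ} (hk : 1 ≤ k) :
    (4 * k ^ 2).choose k ≤ 2 ^ (k + 1) * (2 * k ^ 2).choose k := by
  have hk' : (1 : ℝ) ≤ k := by exact_mod_cast hk
  have hle : k ≤ 2 * k ^ 2 := by nlinarith
  have h1 : ((2 * k ^ 2 : ℕ) : ℝ) ^ k ≤ 2 * ((2 * k ^ 2).descFactorial k : ℝ) := by
    have h2 : (((2 * k ^ 2 + 1 - k) ^ k : ℕ) : ℝ) ≤ (2 * k ^ 2).descFactorial k := by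
      exact_mod_cast Nat.pow_sub_le_descFactorial _ _
    have h3 : ((2 * k ^ 2 + 1 - k : ℕ) : ℝ) =
        (2 * k ^ 2 : ℕ) * (1 + -((k - 1) / (2 * k ^ 2))) := by
      rw [Nat.cast_sub (by omega)]
      push_cast
      field_simp
      ring
    -- Bernoulli's inequality: with a palette quadratic in `k`, drawing without replacement costs
    -- only a factor 2.
    have h4 := one_add_mul_le_pow (a := -(((k : ℝ) - 1) / (2 * k ^ 2))) (by
      rw [neg_le_neg_iff, div_le_iff₀ (by positivity)]
      nlinarith) k
    have h5 : (1 / 2 : ℝ) ≤ 1 + k * -(((k : ℝ) - 1) / (2 * k ^ 2)) := by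
      have : 1 + k * -(((k : ℝ) - 1) / (2 * k ^ 2)) = 1 / 2 + 1 / (2 * k) := by
        field_simp
        ring
      rw [this]
      have : (0 : ℝ) ≤ 1 / (2 * k) := by positivity
      linarith
    rw [Nat.cast_pow, h3, mul_pow] at h2
    have h6 : (0 : ℝ) ≤ ((2 * k ^ 2 : ℕ) : ℝ) ^ k := by positivity
    nlinarith [mul_le_mul_of_nonneg_left (h5.trans h4) h6]
  have h1' : (2 * k ^ 2) ^ k ≤ 2 * (2 * k ^ 2).descFactorial k := by exact_mod_cast h1
  have h2 : (4 * k ^ 2).descFactorial k ≤ 2 ^ (k + 1) * (2 * k ^ 2).descFactorial k :=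
    calc (4 * k ^ 2).descFactorial k ≤ (4 * k ^ 2) ^ k := Nat.descFactorial_le_pow _ _
      _ = 2 ^ k * (2 * k ^ 2) ^ k := by rw [← mul_pow]; ring
      _ ≤ 2 ^ k * (2 * (2 * k ^ 2).descFactorial k) := Nat.mul_le_mul_left _ h1'
      _ = _ := by ring
  rw [Nat.descFactorial_eq_factorial_mul_choose, Nat.descFactorial_eq_factorial_mul_choose] at h2
  refine Nat.le_of_mul_le_mul_left (c := _) ?_ (Nat.factorial_pos k)
  linarith

/-- Disjointness of `A` and `B` ensures that no edge is counted from both ends. -/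
theorem SimpleGraph.card_mul_le_card_monoEdges {V Q : Type*} [Fintype V] [DecidableEq V]
    [DecidableEq Q] (G : SimpleGraph V) [DecidableRel G.Adj] (φ : V → Q) {A B : Finset V}
    (hAB : Disjoint A B) {M : ℕ}
    (hM : ∀ a ∈ A, M ≤ #{b ∈ G.neighborFinset a | b ∈ B ∧ φ b = φ a}) :
    #A * M ≤ #(G.monoEdges φ) := by
  calc #A * M ≤ #(A.sigma fun a => {b ∈ G.neighborFinset a | b ∈ B ∧ φ b = φ a}) := by
        rw [Finset.card_sigma, ← smul_eq_mul]
        exact Finset.card_nsmul_le_sum _ _ _ hM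
    _ ≤ #(G.monoEdges φ) := by
        refine Finset.card_le_card_of_injOn (fun p => s(p.1, p.2)) ?_ ?_
        · rintro ⟨a, b⟩ hp
          simp only [Finset.coe_sigma, Set.mem_sigma_iff, Finset.mem_coe, Finset.mem_filter,
            SimpleGraph.mem_neighborFinset] at hp
          exact SimpleGraph.mk_mem_monoEdges.2 ⟨hp.2.1, hp.2.2.2.symm⟩
        · rintro ⟨a, b⟩ hp ⟨a', b'⟩ hp' heq
          simp only [Finset.coe_sigma, Set.mem_sigma_iff, Finset.mem_coe, Finset.mem_filter,
            SimpleGraph.mem_neighborFinset] at hp hp'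
          rcases Sym2.eq_iff.1 heq with ⟨h1, h2⟩ | ⟨h1, h2⟩
          · subst h1 h2
            rfl
          · subst h1 h2
            exact absurd hp'.2.2.1 (Finset.disjoint_left.1 hAB hp.1)

theorem card_subtype_card_eq_subset {Q : Type*} [Fintype Q] [DecidableEq Q] (k : ℕ)
    (T : Finset Q) :
    #{l : {l : Finset Q // #l = k} | l.1 ⊆ T} = (#T).choose k := by
  rw [← Finset.card_powersetCard, ← Finset.card_map (Function.Embedding.subtype _)]
  congr 1
  ext l
  simp [Finset.mem_powersetCard, and_comm]

/-- If for every large set `T` of colours many elements of `X` have their list inside `T`, then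
every list colouring of `X` uses at least half of the palette often. -/
theorem card_frequent_colours {V Q : Type*} [Fintype Q] [DecidableEq Q] (X : Finset V)
    (S : V → Finset Q) (φ : V → Q) (hφ : ∀ b ∈ X, φ b ∈ S b) {h M : ℕ}
    (hQ : Fintype.card Q = 2 * h)
    (hX : ∀ T : Finset Q, h ≤ #T → 2 * h * M ≤ #{b ∈ X | S b ⊆ T}) :
    h ≤ #{c | M ≤ #{b ∈ X | φ b = c}} := by
  by_contra! hlt
  set C : Finset Q := {c | M ≤ #{b ∈ X | φ b = c}} with hC
  have hcard : #Cᶜ = 2 * h - #C := by rw [Finset.card_compl, hQ]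
  have h1 := hX Cᶜ (by omega)
  -- Pigeonhole over the at most `2 * h` colours of `Cᶜ` yields a frequent colour outside `C`.
  obtain ⟨c, hc, hc'⟩ := Finset.exists_le_card_fiber_of_mul_le_card_of_maps_to
    (s := {b ∈ X | S b ⊆ Cᶜ}) (t := Cᶜ) (f := φ) (n := M)
    (fun b hb => (Finset.mem_filter.1 hb).2 (hφ b (Finset.mem_filter.1 hb).1))
    (Finset.card_pos.1 (by omega))
    (le_trans (Nat.mul_le_mul_right _ (by omega)) h1)
  refine Finset.mem_compl.1 hc (Finset.mem_filter.2 ⟨Finset.mem_univ _, hc'.trans ?_⟩)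
  refine Finset.card_le_card fun b hb => ?_
  rw [Finset.mem_filter, Finset.mem_filter] at hb
  exact Finset.mem_filter.2 ⟨hb.1.1, hb.2⟩

/-- A graph of large minimum degree has lists of size `k` such that each list colouring has at
least `k` times as many monochromatic edges as there are vertices. -/
theorem SimpleGraph.exists_lists_forall_many_monoEdges {V : Type*} [Fintype V] [DecidableEq V]
    [Nonempty V] (G : SimpleGraph V) [DecidableRel G.Adj] {k : ℕ} (hk : 1 ≤ k)
    (hk2 : 4 * k ^ 2 ≤ 2 ^ k) (hdeg : ∀ a, k ^ 4 * 2 ^ (3 * k + 17) ≤ G.degree a) :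
    ∃ L : V → Finset (Fin (4 * k ^ 2)), (∀ v, #(L v) = k) ∧
      ∀ φ : V → Fin (4 * k ^ 2), (∀ v, φ v ∈ L v) →
        k * Fintype.card V ≤ #(G.monoEdges φ) := by
  classical
  let Λ := {l : Finset (Fin (4 * k ^ 2)) // #l = k}
  let ι := {T : Finset (Fin (4 * k ^ 2)) // 2 * k ^ 2 ≤ #T}
  let P : Finset (Fin (4 * k ^ 2)) → Finset Λ := fun T => {l | l.1 ⊆ T}
  set ρ : ℝ := 1 / 2 ^ (k + 1) with hρ
  set n := Fintype.card V with hn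
  have hkq : k ≤ 4 * k ^ 2 := by nlinarith
  have hΛ : Fintype.card Λ = (4 * k ^ 2).choose k := by
    rw [Fintype.card_finset_len, Fintype.card_fin]
  have : Nonempty Λ := by
    rw [← Fintype.card_pos_iff, hΛ]
    exact Nat.choose_pos hkq
  have hP : ∀ T : Finset (Fin (4 * k ^ 2)), 2 * k ^ 2 ≤ #T →
      ρ * Fintype.card Λ ≤ #(P T) := by
    intro T hT
    rw [hΛ, card_subtype_card_eq_subset, hρ, one_div, inv_mul_le_iff₀ (by positivity)]
    exact_mod_cast (choose_four_mul_sq_le hk).trans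
      (Nat.mul_le_mul_left _ (Nat.choose_le_choose k hT))
  have hpow : 2 ^ (k + 7) = 128 * 2 ^ k := by ring
  have hpow4 : 2 ^ (k + 4) = 16 * 2 ^ k := by ring
  have hpow5 : 2 ^ (k + 5) = 32 * 2 ^ k := by ring
  have hpos : 0 < 2 ^ k := by positivity
  -- A frequent colour occurs `k * 2 ^ (k + 5)` times, so `n / 2 ^ (k + 5)` successful vertices give
  -- `k * n` edges; the factor `4 * k ^ 2` pays for the pigeonhole. `N` is chosen so that `k * #B ≤
  -- n / 2 ^ (k + 6)`. The degree bound equals `4 * m * N / ρ`.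
  obtain ⟨B, S, hBS⟩ := G.exists_sparse_labelling (fun T : ι => P T.1) (ρ := ρ)
    (N := k * 2 ^ (k + 7)) (m := 4 * k ^ 2 * (k * 2 ^ (k + 5))) (fun T => hP T.1 T.2)
    (by positivity)
    (by
      intro a
      rw [hρ, div_mul_eq_mul_div, one_mul, le_div_iff₀ (by positivity)]
      refine le_trans (le_of_eq ?_) (Nat.cast_le.2 (hdeg a))
      push_cast
      ring)
    (by
      have h1 : Fintype.card ι ≤ 2 ^ (4 * k ^ 2) := by
        refine (Fintype.card_subtype_le _).trans (le_of_eq ?_)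
        rw [Fintype.card_finset, Fintype.card_fin]
      have h2 : k * 2 ^ (k + 7) ≤ 2 ^ (k + (k + 7)) := by
        rw [pow_add 2 k (k + 7)]
        exact Nat.mul_le_mul_right _ Nat.lt_two_pow_self.le
      refine (Nat.mul_le_mul h1 h2).trans ?_
      rw [← pow_add]
      refine Nat.pow_le_pow_right (by norm_num) ?_
      have h3 : k < 2 ^ k := Nat.lt_two_pow_self
      have h4 : 32 ≤ k * 2 ^ (k + 5) := by rw [hpow5]; nlinarith
      nlinarith [Nat.mul_le_mul_left (4 * k ^ 2) h4])
  set bad : Finset V := {a | a ∈ B ∨ ∃ T : ι,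
    #{b ∈ G.neighborFinset a | b ∈ B ∧ S b ∈ P T.1} < 4 * k ^ 2 * (k * 2 ^ (k + 5))} with hbad
  have hBbad : B ⊆ bad := fun b hb => Finset.mem_filter.2 ⟨Finset.mem_univ _, Or.inl hb⟩
  have hBcard : #B * (k * 2 ^ (k + 7)) ≤ 2 * n :=
    (Nat.mul_le_mul_right _ (Finset.card_le_card hBbad)).trans hBS
  have hAB : Disjoint badᶜ B := disjoint_compl_left.mono_right hBbad
  have hA2 : n ≤ 2 * #badᶜ := by
    have h1 : #bad * 4 ≤ 2 * n :=
      (Nat.mul_le_mul_left _ (by rw [hpow]; nlinarith)).trans hBS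
    rw [Finset.card_compl]
    omega
  have hgood : ∀ a ∈ badᶜ, ∀ T : Finset (Fin (4 * k ^ 2)), 2 * k ^ 2 ≤ #T →
      2 * (2 * k ^ 2) * (k * 2 ^ (k + 5)) ≤
        #{b ∈ {b ∈ G.neighborFinset a | b ∈ B} | (S b).1 ⊆ T} := by
    intro a ha T hT
    rw [Finset.mem_compl, hbad, Finset.mem_filter] at ha
    simp only [Finset.mem_univ, true_and, not_or, not_exists, not_lt] at ha
    have := ha.2 ⟨T, hT⟩
    rw [Finset.filter_filter]
    simp only [P, Finset.mem_filter, Finset.mem_univ, true_and] at this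
    refine le_trans (le_of_eq ?_) this
    ring
  have hnlarge : 2 ^ (k + 4) ≤ n := by
    obtain ⟨a⟩ := ‹Nonempty V›
    have h1 := (hdeg a).trans (G.degree_lt_card_verts a).le
    refine le_trans ?_ h1
    calc 2 ^ (k + 4) ≤ 2 ^ (3 * k + 17) := Nat.pow_le_pow_right (by norm_num) (by omega)
      _ ≤ _ := Nat.le_mul_of_pos_left _ (by positivity)
  set m := n / 2 ^ (k + 4) with hm
  have hm1 : 1 ≤ m := (Nat.one_le_div_iff (by positivity)).2 hnlarge
  have hmle : m * 2 ^ (k + 4) ≤ n := Nat.div_mul_le_self _ _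
  have hmlt : n < m * 2 ^ (k + 5) := by
    have h1 : n < 2 ^ (k + 4) * (m + 1) := Nat.lt_mul_div_succ n (by positivity)
    rw [hpow4] at h1
    rw [hpow5]
    nlinarith
  -- Freezing the colour to `c₀` off `B` leaves only the `k ^ #B` list colourings of `B` in the
  -- union bound.
  let c₀ : Fin (4 * k ^ 2) := ⟨0, by positivity⟩
  let Φ : Finset (V → Fin (4 * k ^ 2)) :=
    Fintype.piFinset fun v => if v ∈ B then (S v).1 else {c₀}
  have hΦ : Fintype.card Φ < 2 ^ m := by
    have h1 : Fintype.card Φ = k ^ #B := by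
      rw [Fintype.card_coe, Fintype.card_piFinset]
      have : ∀ v, #(if v ∈ B then (S v).1 else {c₀}) = if v ∈ B then k else 1 := by
        intro v
        split_ifs
        · exact (S v).2
        · simp
      simp only [this]
      rw [Finset.prod_ite_mem, Finset.univ_inter, Finset.prod_const]
    rw [h1]
    calc k ^ #B ≤ (2 ^ k) ^ #B := Nat.pow_le_pow_left (hkq.trans hk2) _
      _ = 2 ^ (k * #B) := by rw [pow_mul]
      _ < 2 ^ m := by
        refine Nat.pow_lt_pow_right (by norm_num) ?_
        rw [hpow] at hBcard
        rw [hpow5] at hmlt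
        by_contra! hcon
        nlinarith [Nat.mul_le_mul_right (2 ^ k) hcon]
  let C : (V → Fin (4 * k ^ 2)) → V → Finset (Fin (4 * k ^ 2)) := fun φ a =>
    {c | k * 2 ^ (k + 5) ≤ #{b ∈ {b ∈ G.neighborFinset a | b ∈ B} | φ b = c}}
  obtain ⟨R, hR⟩ := exists_function_forall_many_hits (badᶜ)
    (fun (φ : Φ) a => P (C φ.1 a)) (ρ := ρ) (m := m)
    (by
      intro φ a ha
      refine hP _ (card_frequent_colours _ (fun b => (S b).1) _ (fun b hb => ?_)
        (by rw [Fintype.card_fin]; ring) (hgood a ha))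
      have := Fintype.mem_piFinset.1 φ.2 b
      rwa [if_pos (Finset.mem_filter.1 hb).2] at this)
    (by
      rw [hρ, div_mul_eq_mul_div, one_mul, le_div_iff₀ (by positivity)]
      have : 4 * m * 2 ^ (k + 1) ≤ #badᶜ := by
        have : 2 * (4 * m * 2 ^ (k + 1)) = m * 2 ^ (k + 4) := by ring
        omega
      exact_mod_cast this)
    hΦ
  refine ⟨fun v => if v ∈ B then (S v).1 else (R v).1, fun v => ?_, fun φ hφ => ?_⟩
  · dsimp only
    split_ifs
    · exact (S v).2
    · exact (R v).2
  · let φ' : V → Fin (4 * k ^ 2) := fun v => if v ∈ B then φ v else c₀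
    have hφ' : φ' ∈ Φ := by
      refine Fintype.mem_piFinset.2 fun v => ?_
      have := hφ v
      by_cases hv : v ∈ B
      · simpa [φ', hv] using this
      · simp [φ', hv]
    have h1 := hR ⟨φ', hφ'⟩
    have h2 := G.card_mul_le_card_monoEdges φ (M := k * 2 ^ (k + 5))
      (A := {a ∈ badᶜ | R a ∈ P (C φ' a)}) (hAB.mono_left (Finset.filter_subset _ _)) (by
        intro a ha
        rw [Finset.mem_filter] at ha
        have haB : a ∉ B := Finset.disjoint_left.1 hAB ha.1
        have h3 := hφ a
        simp only [if_neg haB] at h3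
        have h4 := (Finset.mem_filter.1 ((Finset.mem_filter.1 ha.2).2 h3)).2
        refine h4.trans (Finset.card_le_card fun b hb => ?_)
        rw [Finset.mem_filter, Finset.mem_filter] at hb
        refine Finset.mem_filter.2 ⟨hb.1.1, hb.1.2, ?_⟩
        have := hb.2
        rwa [show φ' b = φ b from if_pos hb.1.2] at this)
    refine le_trans ?_ h2
    refine le_trans ?_ (Nat.mul_le_mul_right _ h1)
    nlinarith [Nat.mul_le_mul_left k hmlt.le]

/-! ### From lists to dichoosability, and reduction to minimum degree -/

/-- The union bound totals at most `(4 * k ^ 2 * 2 * (3 / 4) ^ k) ^ n`, which `hk2` makes less than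
1. -/
theorem SimpleGraph.exists_orientation_not_isDichoosable {V : Type*} [Fintype V] [DecidableEq V]
    [Nonempty V] (G : SimpleGraph V) [DecidableRel G.Adj] {k : ℕ} (hk : 1 ≤ k)
    (hk2 : 8 * (k : ℝ) ^ 2 * (3 / 4) ^ k < 1)
    (hdeg : ∀ a, k ^ 4 * 2 ^ (3 * k + 17) ≤ G.degree a) :
    ∃ D : Digraph V, D.IsOrientation G ∧ ¬ D.IsDichoosable k := by
  have hk3 : 4 * k ^ 2 ≤ 2 ^ k := by
    have h1 : (1 : ℝ) ≤ 2 ^ k * (3 / 4) ^ k := by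
      rw [← mul_pow]
      exact one_le_pow₀ (by norm_num)
    have h2 : (0 : ℝ) < (3 / 4) ^ k := by positivity
    have h3 : 8 * (k : ℝ) ^ 2 < 2 ^ k := lt_of_mul_lt_mul_right (hk2.trans_le h1) h2.le
    have h4 : 8 * k ^ 2 < 2 ^ k := by exact_mod_cast h3
    omega
  obtain ⟨L, hLk, hL⟩ := G.exists_lists_forall_many_monoEdges hk hk3 hdeg
  obtain ⟨D, hD, hcyc⟩ := G.exists_orientation_forall_hasMonoCycle (Fintype.piFinset L)
    (k * Fintype.card V) (fun φ hφ => hL φ (Fintype.mem_piFinset.1 hφ)) (by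
      have h1 : (#(Fintype.piFinset L) : ℝ) ≤ (4 * (k : ℝ) ^ 2) ^ Fintype.card V := by
        have h2 : #(Fintype.piFinset L) ≤ (4 * k ^ 2) ^ Fintype.card V := by
          refine (Finset.card_le_univ _).trans (le_of_eq ?_)
          rw [Fintype.card_fun, Fintype.card_fin]
        exact_mod_cast h2
      refine lt_of_le_of_lt (mul_le_mul_of_nonneg_right h1 (by positivity)) ?_
      rw [pow_mul, ← mul_pow, ← mul_pow]
      refine pow_lt_one₀ (by positivity) (lt_of_eq_of_lt (by ring) hk2) Fintype.card_ne_zero)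
  refine ⟨D, hD, fun hch => ?_⟩
  let e : Fin (4 * k ^ 2) ↪ ℕ+ :=
    ⟨fun i => Nat.succPNat i, Nat.succPNat_injective.comp Fin.val_injective⟩
  obtain ⟨φ, hφ, hcol⟩ := hch (fun v => (L v).map e) fun v => by
    rw [Finset.card_map, hLk]
  have : ∀ v, ∃ c ∈ L v, e c = φ v := fun v => Finset.mem_map.1 (hφ v)
  choose ψ hψ hψe using this
  obtain ⟨n, c, hc, hmono⟩ := hcyc ψ (Fintype.mem_piFinset.2 hψ)
  exact Digraph.HasMonoCycle.not_isDicolouring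
    ⟨n, c, hc, fun i => by rw [← hψe, ← hψe, hmono i]⟩ hcol

/-- An orientation of an induced subgraph that is not `k`-dichoosable extends to such an
orientation of the whole graph. -/
theorem SimpleGraph.exists_orientation_not_isDichoosable_of_induce {V : Type*}
    (G : SimpleGraph V) (U : Set V) {k : ℕ}
    (h : ∃ D : Digraph U, D.IsOrientation (G.induce U) ∧ ¬ D.IsDichoosable k) :
    ∃ D : Digraph V, D.IsOrientation G ∧ ¬ D.IsDichoosable k := by
  classical
  obtain ⟨D', hD', hnot⟩ := h
  obtain ⟨D₀, hD₀⟩ := G.exists_isOrientation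
  have hadj' : ∀ u v, (G.induce U).Adj u v ↔ u ≠ v ∧ (D'.Adj u v ∨ D'.Adj v u) := by
    intro u v
    rw [← hD'.underlying, Digraph.toSimpleGraphInclusive, SimpleGraph.fromRel_adj]
  have hadj₀ : ∀ u v, G.Adj u v ↔ u ≠ v ∧ (D₀.Adj u v ∨ D₀.Adj v u) := by
    intro u v
    rw [← hD₀.underlying, Digraph.toSimpleGraphInclusive, SimpleGraph.fromRel_adj]
  let D : Digraph V := ⟨fun u v =>
    if h : u ∈ U ∧ v ∈ U then D'.Adj ⟨u, h.1⟩ ⟨v, h.2⟩ else D₀.Adj u v⟩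
  have hDU : ∀ u v : U, D.Adj u v ↔ D'.Adj u v := by
    intro u v
    simp [D]
  have hDn : ∀ u v, ¬ (u ∈ U ∧ v ∈ U) → (D.Adj u v ↔ D₀.Adj u v) := by
    intro u v huv
    simp only [D, dif_neg huv]
  refine ⟨D, ⟨?_, ?_⟩, fun hD => hnot fun L hL => ?_⟩
  · ext u v
    rw [Digraph.toSimpleGraphInclusive, SimpleGraph.fromRel_adj]
    by_cases huv : u ∈ U ∧ v ∈ U
    · have := hadj' ⟨u, huv.1⟩ ⟨v, huv.2⟩
      rw [← hDU, ← hDU] at this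
      simpa using this.symm
    · rw [hDn u v huv, hDn v u fun h => huv h.symm, hadj₀]
  · intro u v huv hvu
    by_cases h : u ∈ U ∧ v ∈ U
    · exact hD'.asymm _ _ ((hDU ⟨u, h.1⟩ ⟨v, h.2⟩).1 huv) ((hDU ⟨v, h.2⟩ ⟨u, h.1⟩).1 hvu)
    · exact hD₀.asymm _ _ ((hDn u v h).1 huv) ((hDn v u fun h' => h h'.symm).1 hvu)
  · obtain ⟨φ, hφ, hcol⟩ := hD
      (fun v => if h : v ∈ U then L ⟨v, h⟩ else
        (Finset.range k).map ⟨Nat.succPNat, Nat.succPNat_injective⟩) (by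
      intro v
      dsimp only
      split_ifs with h
      · exact hL _
      · simp)
    refine ⟨fun v => φ v, fun v => by simpa using hφ v, fun i n c hc => ?_⟩
    refine hcol i n (fun j => ⟨(c j).1.1, (c j).2⟩) ⟨fun a b hab => hc.1 ?_, fun j => ?_⟩
    · exact Subtype.ext (Subtype.ext (by simpa using hab))
    · exact (hDU _ _).2 (hc.2 j)

/-- A graph of average degree at least `d > 0` has an induced subgraph of minimum degree at least
`d / 2`. -/
theorem SimpleGraph.exists_induced_minDegree {V : Type*} [Fintype V] [DecidableEq V]
    (G : SimpleGraph V) [DecidableRel G.Adj] {d : ℝ} (hd : 0 < d) (hG : d ≤ G.averageDegree) :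
    ∃ U : Finset V, U.Nonempty ∧ ∀ v ∈ U, d / 2 ≤ #{w ∈ U | G.Adj v w} := by
  let T : Finset V → Prop := fun U =>
    U.Nonempty ∧ d * #U ≤ ∑ v ∈ U, (#{w ∈ U | G.Adj v w} : ℝ)
  have hT : T univ := by
    rw [SimpleGraph.averageDegree] at hG
    have hne : Fintype.card V ≠ 0 := by
      intro h
      rw [h, Nat.cast_zero, div_zero] at hG
      linarith
    refine ⟨Finset.card_pos.1 (Nat.pos_of_ne_zero hne), ?_⟩
    rw [le_div_iff₀ (by exact_mod_cast Nat.pos_of_ne_zero hne)] at hG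
    refine hG.trans (le_of_eq (Finset.sum_congr rfl fun v _ => ?_))
    rw [← SimpleGraph.card_neighborFinset_eq_degree]
    congr 2
    ext w
    simp
  obtain ⟨U, hU, hmin⟩ := exists_minimal_of_wellFoundedLT T ⟨univ, hT⟩
  refine ⟨U, hU.1, fun v hv => ?_⟩
  by_contra! hlt
  -- Deleting a vertex of degree below `d / 2` lowers the degree sum by less than `d`, so `T`
  -- survives, against minimality.
  have hsum : ∑ u ∈ U, (#{w ∈ U | G.Adj u w} : ℝ) =
      ∑ u ∈ U.erase v, (#{w ∈ U.erase v | G.Adj u w} : ℝ) + 2 * #{w ∈ U | G.Adj v w} := by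
    have h1 : ∀ u, (#{w ∈ U | G.Adj u w} : ℝ) =
        #{w ∈ U.erase v | G.Adj u w} + if G.Adj u v then 1 else 0 := by
      intro u
      simp only [Finset.card_filter]
      rw [← Finset.sum_erase_add _ _ hv]
      push_cast
      rfl
    have h2 : ∑ u ∈ U.erase v, (if G.Adj u v then 1 else 0 : ℝ) = #{w ∈ U | G.Adj v w} := by
      have h3 := h1 v
      rw [if_neg (G.loopless.irrefl v), add_zero] at h3
      rw [h3, Finset.card_filter]
      push_cast
      simp only [G.adj_comm v]
    rw [← Finset.sum_erase_add _ _ hv, Finset.sum_congr rfl fun u _ => h1 u,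
      Finset.sum_add_distrib, h2]
    ring
  have hcard : (#U : ℝ) = #(U.erase v) + 1 := by
    exact_mod_cast (Finset.card_erase_add_one hv).symm
  have hge := hU.2
  rw [hsum, hcard] at hge
  have hT' : T (U.erase v) := by
    refine ⟨?_, by linarith⟩
    by_contra hemp
    rw [Finset.not_nonempty_iff_eq_empty] at hemp
    rw [hemp] at hge
    simp at hge
    linarith
  exact Finset.notMem_erase v U (hmin hT' (Finset.erase_subset v U) hv)

theorem mainTheorem2 :
    ∃ r₀ : ℕ, ∀ r : ℕ, r₀ ≤ r →
      ∀ (V : Type*) [Fintype V] (G : SimpleGraph V) [DecidableRel G.Adj],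
        (r : ℝ) ^ 7 * 2 ^ (3 * r + 17) ≤ G.averageDegree →
          r ≤ G.dichoosability := by
  -- The decay of `r ^ 2 * (3 / 4) ^ r` determines `r₀`; apart from it only `r ≥ 2` is needed.
  have hlim := (tendsto_pow_const_mul_const_pow_of_abs_lt_one 2
    (by rw [abs_of_nonneg] <;> norm_num : |(3 / 4 : ℝ)| < 1)).eventually_lt_const
    (by norm_num : (0 : ℝ) < 1 / 8)
  obtain ⟨r₁, hr₁⟩ := Filter.eventually_atTop.1 hlim
  refine ⟨max r₁ 2, fun r hr V _ G _ hG => ?_⟩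
  classical
  have hr2 : 2 ≤ r := (le_max_right _ _).trans hr
  have hsmall : 8 * (r : ℝ) ^ 2 * (3 / 4) ^ r < 1 := by
    have := hr₁ r ((le_max_left _ _).trans hr)
    linarith
  have hrpos : (0 : ℝ) < r := by exact_mod_cast (by omega : 0 < r)
  obtain ⟨U, hUne, hU⟩ := G.exists_induced_minDegree (by positivity) hG
  obtain ⟨D, hD, hnot⟩ : ∃ D : Digraph V, D.IsOrientation G ∧ ¬ D.IsDichoosable r := by
    apply G.exists_orientation_not_isDichoosable_of_induce (U : Set V)
    have : Nonempty (U : Set V) := hUne.to_subtype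
    refine (G.induce (U : Set V)).exists_orientation_not_isDichoosable (by omega) hsmall ?_
    intro a
    have h1 := hU a.1 a.2
    have h2 : #{w ∈ U | G.Adj a w} = (G.induce (U : Set V)).degree a := by
      rw [← SimpleGraph.card_neighborFinset_eq_degree,
        ← Finset.card_map (Function.Embedding.subtype _)]
      congr 1
      ext w
      simp [and_comm]
    rw [h2] at h1
    have h3 : (r : ℝ) ^ 4 * 2 ^ (3 * r + 17) ≤ (G.induce (U : Set V)).degree a := by
      refine le_trans ?_ h1
      have h4 : (8 : ℝ) ≤ r ^ 3 := by
        have : (2 : ℝ) ≤ r := by exact_mod_cast hr2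
        calc (8 : ℝ) = 2 ^ 3 := by norm_num
          _ ≤ r ^ 3 := pow_le_pow_left₀ (by norm_num) this 3
      have h5 : (0 : ℝ) ≤ (r : ℝ) ^ 4 * 2 ^ (3 * r + 17) := by positivity
      have h6 : (r : ℝ) ^ 7 * 2 ^ (3 * r + 17) / 2 = (r ^ 3 / 2) * (r ^ 4 * 2 ^ (3 * r + 17)) := by
        ring
      rw [h6]
      nlinarith
    exact_mod_cast h3
  refine le_trans ?_ (G.isGreatest_dichoosability.2 ⟨D, hD, rfl⟩)
  -- Nonemptiness matters, as `sInf ∅ = 0`. A `j`-dichoosable digraph with `j < r` would be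
  -- `r`-dichoosable, since `r`-lists are also `j`-lists.
  refine le_csInf ⟨_, D.isDichoosable_card fun v h => hD.asymm v v h h⟩ fun j hj => ?_
  by_contra! hlt
  exact hnot fun L hL => hj L fun v => hlt.le.trans (hL v)
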